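/- **Theorem A.** Let $(X,Y)$ be a random couple with values in $\mathcal X\times\mathbb R$, where $\mathcal X$ is a measurable space and $\mathbb E Y^2<\infty$. Let $F=\{f_1,\dots,f_M\}$ be measurable real functions on $\mathcal X$ with $\mathbb E f_j(X)^2<\infty$, and write $\|f\|_{L_2}=(\mathbb E f(X)^2)^{1/2}$ and $R(f)=\mathbb E(Y-f(X))^2$. Assume that there are constants $\kappa_0,\beta_0>0$ such that $$P\big(|f(X)|\ge\kappa_0\|f\|_{L_2}\big)\ge\beta_0\qquad\text{for every } f\in\mathrm{span}(F).$$ Let $f^*\in\mathrm{span}(F)$ satisfy $R(f^*)=\min_{f\in\mathrm{span}(F)}R(f)$ and set $\zeta=Y-f^*(X)$. Let $\sigma\in\mathbb R$ and assume that either 1. $\zeta$ is independent of $X$ and $\mathbb E\zeta^2\le\sigma^2$, or 2. $|\zeta|\le\sigma$ almost surely. Let $N\ge 400^2M/\beta_0^2$ and let $(X_1,Y_1),\dots,(X_N,Y_N)$ be independent copies of $(X,Y)$. Then for every $x>0$, with probability at least $1-\exp(-\beta_0^2N/4)-1/x$, every empirical risk minimizer $$\hat f\in\operatorname*{argmin}_{f\in\mathrm{span}(F)}\frac1N\sum_{i=1}^N\big(Y_i-f(X_i)\big)^2$$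 satisfies $$\|\hat f-f^*\|_{L_2}^2=R(\hat f)-\min_{f\in\mathrm{span}(F)}R(f)\le\Big(\frac{16}{\beta_0\kappa_0^2}\Big)^2\frac{\sigma^2Mx}{N}.$$ Here $R(\hat f)$ and $\|\hat f-f^*\|_{L_2}$ are computed conditionally on the sample, that is, with $\hat f$ held fixed. -/

import Mathlib

open MeasureTheory ProbabilityTheory

noncomputable section

/-- The linear span, inside the space of all real functions on `𝒳`, of a dictionary
`f 0, …, f (M - 1)`. -/
def dictSpan {𝒳 : Type*} {M : ℕ} (f : Fin M → 𝒳 → ℝ) : Submodule ℝ (𝒳 → ℝ) :=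
  Submodule.span ℝ (Set.range f)

/-- The norm `‖g‖_{L₂} = (E g(X)²)^{1/2}`. -/
def l2Norm {Ω 𝒳 : Type*} [MeasurableSpace Ω] (P : Measure Ω) (X : Ω → 𝒳) (g : 𝒳 → ℝ) : ℝ :=
  Real.sqrt (∫ ω, (g (X ω)) ^ 2 ∂P)

/-- The squared risk `R(g) = E (Y - g(X))²`. -/
def risk {Ω 𝒳 : Type*} [MeasurableSpace Ω] (P : Measure Ω) (X : Ω → 𝒳) (Y : Ω → ℝ)
    (g : 𝒳 → ℝ) : ℝ :=
  ∫ ω, (Y ω - g (X ω)) ^ 2 ∂P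

/-- The empirical risk `R_N(g) = (1/N) ∑ᵢ (yᵢ - g(xᵢ))²` of a sample `(xᵢ, yᵢ)`. -/
def empiricalRisk {𝒳 : Type*} {N : ℕ} (x : Fin N → 𝒳) (y : Fin N → ℝ) (g : 𝒳 → ℝ) : ℝ :=
  (1 / (N : ℝ)) * ∑ i, (y i - g (x i)) ^ 2

/-- `g` minimizes the functional `R` over the linear space `V` (and belongs to `V`). -/
def IsArgmin {𝒳 : Type*} (R : (𝒳 → ℝ) → ℝ) (V : Submodule ℝ (𝒳 → ℝ)) (g : 𝒳 → ℝ) : Prop :=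
  g ∈ V ∧ ∀ h ∈ V, R g ≤ R h

/-- The small-ball condition on a linear space `V` of functions with constants `κ₀`, `β₀`:
`P(|g(X)| ≥ κ₀ ‖g‖_{L₂}) ≥ β₀` for every `g ∈ V`. -/
def SmallBall {Ω 𝒳 : Type*} [MeasurableSpace Ω] (P : Measure Ω) (X : Ω → 𝒳)
    (V : Submodule ℝ (𝒳 → ℝ)) (κ₀ β₀ : ℝ) : Prop :=
  ∀ g ∈ V, β₀ ≤ P.real {ω | κ₀ * l2Norm P X g ≤ |g (X ω)|}

end

/-!
For `h = fhat - f*`, minimality of the empirical risk gives the basic inequality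
`∑ h(X_i)² ≤ 2 ∑ ζ_i h(X_i)`, where `ζ_i = Y_i - f*(X_i)`. It remains to bound the left side from
below and the right side from above, uniformly in `h` in the span.

Everything is expressed in coordinates with respect to an `L₂`-orthonormal family `e` of `d ≤ M`
functions of the span (`exists_orthonormal_coordinates`): with `v_i = e(X_i) ∈ ℝ^d` one has, almost
surely and simultaneously for all `h`, `h(X_i) = c ⬝ᵥ v_i` and `‖h‖² = c ⬝ᵥ c`.

*Lower bound.* Off an event of probability at most `exp (-β² N / 4)`, every `c` satisfies
`|c ⬝ᵥ v_i| ≥ κ |c|` for at least `β N / 8` indices (`exists_uniform_smallBall`). Suppose that `c` is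
small on all points of a set `T` of indices. Maximizing the norm over the polytope
`|g ⬝ᵥ v_i| ≤ κ` (`i ∈ T`), `|g k| ≤ 2` yields a vertex, which is still small on `T`
(`exists_vertexSol_small`), and a vertex is the solution of `d` active linear equations. It is
therefore a function of at most `d` sample points and of one of `(2 (N + d)).choose d` choices of
equations. Given those points, the remaining ones are independent of the vertex, so a Chernoff bound
applies (`measure_card_lt_le`), and the union bound over the choices is affordable since
`N ≥ 400² d / β²` (`choose_le_exp`). Neither symmetrization nor chaining is needed.

*Upper bound.* By Cauchy–Schwarz the right side is at most `2 N |c| √Z`, where `Z` is the squared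
norm of `N⁻¹ ∑ ζ_i v_i`. The summands are centered, by first-order optimality of `f*`
(`integral_residual_mul_eq_zero`), and under either noise assumption each coordinate has second
moment at most `σ²`. Hence `E Z ≤ σ² d / N`, and Markov's inequality gives `Z ≤ σ² M x / N` outside
an event of probability at most `1 / x`.

The two bounds combine to `|c|² ≤ (16 / (β κ²))² Z` (`dotProduct_self_le_of_empirical`).
-/

/-! ### Vertices of polytopes and sample compression -/

open Matrix in
/-- The solution `g` of the linear equations `w a ⬝ᵥ g = κ` for `a ∈ S`, written through the normal
equations `(∑ w_a w_aᵀ) g = κ ∑ w_a`. This needs no enumeration of `S`, and it is a measurable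
function of the `w a`; it has a junk value when the `w a`, `a ∈ S`, do not span. -/
noncomputable def vertexSol {ι : Type*} {d : ℕ} (κ : ℝ) (w : ι → Fin d → ℝ) (S : Finset ι) :
    Fin d → ℝ :=
  (∑ a ∈ S, vecMulVec (w a) (w a))⁻¹ *ᵥ (κ • ∑ a ∈ S, w a)

/-- The vectors of the signed constraints: `± v i` for the points, `± (κ / 2) e_k` for the box.
The inequalities `w ⬝ᵥ g ≤ κ` say that `|v i ⬝ᵥ g| ≤ κ` and `|g k| ≤ 2`. -/
noncomputable def constraintVec {ι : Type*} {d : ℕ} (κ : ℝ) (v : ι → Fin d → ℝ) :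
    (ι ⊕ Fin d) × Bool → Fin d → ℝ
  | (Sum.inl i, true) => v i
  | (Sum.inl i, false) => -v i
  | (Sum.inr k, true) => Pi.single k (κ / 2)
  | (Sum.inr k, false) => -Pi.single k (κ / 2)

open Matrix in
theorem vecMulVec_sum_mulVec {ι : Type*} {d : ℕ} (w : ι → Fin d → ℝ) (S : Finset ι)
    (u : Fin d → ℝ) :
    (∑ a ∈ S, vecMulVec (w a) (w a)) *ᵥ u = ∑ a ∈ S, (w a ⬝ᵥ u) • w a := by
  rw [Matrix.sum_mulVec]
  refine Finset.sum_congr rfl fun a _ => ?_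
  rw [Matrix.vecMulVec_mulVec]
  ext k
  simp [mul_comm]

open Matrix in
theorem eq_vertexSol {ι : Type*} {d : ℕ} {κ : ℝ} {w : ι → Fin d → ℝ} {S : Finset ι}
    (hS : ∀ u : Fin d → ℝ, (∀ a ∈ S, w a ⬝ᵥ u = 0) → u = 0) {g : Fin d → ℝ}
    (hg : ∀ a ∈ S, w a ⬝ᵥ g = κ) : g = vertexSol κ w S := by
  set G := ∑ a ∈ S, vecMulVec (w a) (w a) with hG
  -- `u ⬝ᵥ G *ᵥ u = ∑ (w a ⬝ᵥ u) ^ 2`, so a kernel vector is orthogonal to all `w a`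
  have hdet : G.det ≠ 0 := by
    intro h0
    obtain ⟨u, hu, hGu⟩ := Matrix.exists_mulVec_eq_zero_iff.2 h0
    refine hu (hS u ?_)
    have h1 : ∑ a ∈ S, (w a ⬝ᵥ u) ^ 2 = 0 := by
      have : u ⬝ᵥ (G *ᵥ u) = 0 := by rw [hGu]; simp
      rw [hG, vecMulVec_sum_mulVec, dotProduct_sum] at this
      rw [← this]
      refine Finset.sum_congr rfl fun a _ => ?_
      rw [dotProduct_smul, dotProduct_comm u, smul_eq_mul, sq]
    intro a ha
    have := (Finset.sum_eq_zero_iff_of_nonneg (fun a _ => sq_nonneg (w a ⬝ᵥ u))).1 h1 a ha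
    exact pow_eq_zero_iff (two_ne_zero) |>.1 this
  have hGg : G *ᵥ g = κ • ∑ a ∈ S, w a := by
    rw [hG, vecMulVec_sum_mulVec, Finset.smul_sum]
    exact Finset.sum_congr rfl fun a ha => by rw [hg a ha]
  rw [vertexSol, ← hG, ← hGg, Matrix.mulVec_mulVec, Matrix.nonsing_inv_mul _ hdet.isUnit,
    Matrix.one_mulVec]

open Matrix in
/-- A spanning family in `ℝ^d` contains a spanning subfamily of exactly `d` members; spanning is
expressed by the triviality of the orthogonal complement. -/
theorem exists_subset_card_eq_of_orthogonal_trivial {ι : Type*} {d : ℕ} (w : ι → Fin d → ℝ)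
    (A : Finset ι) (hA : ∀ u : Fin d → ℝ, (∀ a ∈ A, w a ⬝ᵥ u = 0) → u = 0) :
    ∃ S ⊆ A, S.card = d ∧ ∀ u : Fin d → ℝ, (∀ a ∈ S, w a ⬝ᵥ u = 0) → u = 0 := by
  classical
  obtain ⟨K, b, hb, hspan, hli⟩ := exists_linearIndependent' ℝ (fun a : A => w a)
  have : Fintype K := Fintype.ofInjective b hb
  set S : Finset ι := Finset.univ.image fun k => (b k : ι) with hSdef
  have hcard : S.card = Fintype.card K :=
    Finset.card_image_of_injective _ (Subtype.val_injective.comp hb)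
  have hS : ∀ u : Fin d → ℝ, (∀ a ∈ S, w a ⬝ᵥ u = 0) → u = 0 := by
    intro u hu
    refine hA u fun a ha => ?_
    have hmem : w a ∈ Submodule.span ℝ (Set.range ((fun a : A => w a) ∘ b)) := by
      rw [hspan]
      exact Submodule.subset_span ⟨⟨a, ha⟩, rfl⟩
    refine Submodule.span_induction (p := fun y _ => y ⬝ᵥ u = 0) ?_ ?_ ?_ ?_ hmem
    · rintro _ ⟨k, rfl⟩
      exact hu _ (Finset.mem_image_of_mem _ (Finset.mem_univ k))
    · simp
    · intro y z _ _ hy hz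
      rw [add_dotProduct, hy, hz, add_zero]
    · intro r y _ hy
      rw [smul_dotProduct, hy, smul_zero]
  refine ⟨S, ?_, le_antisymm ?_ ?_, hS⟩
  · intro a ha
    obtain ⟨k, -, rfl⟩ := Finset.mem_image.1 ha
    exact (b k).2
  · rw [hcard]
    simpa using hli.fintype_card_le_finrank
  · have hinj : Function.Injective
        (Matrix.mulVecLin (Matrix.of fun a : S => w a)) := by
      rw [← LinearMap.ker_eq_bot, LinearMap.ker_eq_bot']
      intro u hu
      exact hS u fun a ha => congrFun hu ⟨a, ha⟩
    simpa using LinearMap.finrank_le_finrank_of_injective hinj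

open Matrix in
/-- A maximizer of the Euclidean norm over a compact polyhedron is a vertex: the active constraints
have trivial orthogonal complement, as otherwise the maximizer could be moved in both directions
along a line, and one of the two increases the norm. -/
theorem exists_vertex {ι : Type*} {d : ℕ} (κ : ℝ) (w : ι → Fin d → ℝ) (A : Finset ι)
    (hK : IsCompact {g : Fin d → ℝ | ∀ a ∈ A, w a ⬝ᵥ g ≤ κ}) {c : Fin d → ℝ}
    (hc : ∀ a ∈ A, w a ⬝ᵥ c ≤ κ) :
    ∃ S ⊆ A, S.card = d ∧ (∀ a ∈ A, w a ⬝ᵥ vertexSol κ w S ≤ κ) ∧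
      c ⬝ᵥ c ≤ vertexSol κ w S ⬝ᵥ vertexSol κ w S := by
  classical
  have hcont : ContinuousOn (fun g : Fin d → ℝ => g ⬝ᵥ g)
      {g : Fin d → ℝ | ∀ a ∈ A, w a ⬝ᵥ g ≤ κ} := by
    unfold dotProduct
    fun_prop
  obtain ⟨g, hgK, hmax⟩ := hK.exists_isMaxOn ⟨c, hc⟩ hcont
  have hact : ∀ u : Fin d → ℝ,
      (∀ a ∈ A.filter (fun a => w a ⬝ᵥ g = κ), w a ⬝ᵥ u = 0) → u = 0 := by
    intro u hu
    have hsmall : ∀ᶠ t : ℝ in nhdsWithin 0 (Set.Ioi 0), ∀ a ∈ A,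
        w a ⬝ᵥ (g + t • u) ≤ κ ∧ w a ⬝ᵥ (g - t • u) ≤ κ := by
      rw [Filter.eventually_all_finset]
      intro a ha
      by_cases hact : w a ⬝ᵥ g = κ
      · have h0 := hu a (Finset.mem_filter.2 ⟨ha, hact⟩)
        refine Filter.Eventually.of_forall fun t => ?_
        rw [dotProduct_add, dotProduct_sub, dotProduct_smul, h0, hact]
        simp
      · have hlt : w a ⬝ᵥ g < κ := lt_of_le_of_ne (hgK a ha) hact
        refine (nhdsWithin_le_nhds (a := (0 : ℝ)) (s := Set.Ioi 0)) ?_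
        have h1 : Continuous fun t : ℝ => w a ⬝ᵥ (g + t • u) := by
          simp only [dotProduct_add, dotProduct_smul]; fun_prop
        have h2 : Continuous fun t : ℝ => w a ⬝ᵥ (g - t • u) := by
          simp only [dotProduct_sub, dotProduct_smul]; fun_prop
        have e1 := h1.continuousAt (x := 0) |>.eventually_lt continuousAt_const
          (by simpa using hlt : w a ⬝ᵥ (g + (0 : ℝ) • u) < κ)
        have e2 := h2.continuousAt (x := 0) |>.eventually_lt continuousAt_const
          (by simpa using hlt : w a ⬝ᵥ (g - (0 : ℝ) • u) < κ)
        filter_upwards [e1, e2] with t ht1 ht2 using ⟨ht1.le, ht2.le⟩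
    obtain ⟨t, ht, htpos⟩ := (hsmall.and self_mem_nhdsWithin).exists
    have htpos : 0 < t := htpos
    have m1 : (g + t • u) ⬝ᵥ (g + t • u) ≤ g ⬝ᵥ g := hmax fun a ha => (ht a ha).1
    have m2 : (g - t • u) ⬝ᵥ (g - t • u) ≤ g ⬝ᵥ g := hmax fun a ha => (ht a ha).2
    simp only [add_dotProduct, dotProduct_add, sub_dotProduct, dotProduct_sub, smul_dotProduct,
      dotProduct_smul, smul_eq_mul, dotProduct_comm u g] at m1 m2
    have hu0 : 0 ≤ u ⬝ᵥ u := Finset.sum_nonneg fun i _ => mul_self_nonneg _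
    have : t * (t * (u ⬝ᵥ u)) ≤ 0 := by linarith
    have h3 : u ⬝ᵥ u ≤ 0 := by
      by_contra hpos
      have : 0 < t * (t * (u ⬝ᵥ u)) := mul_pos htpos (mul_pos htpos (not_le.1 hpos))
      linarith
    exact dotProduct_self_eq_zero.1 (le_antisymm h3 hu0)
  obtain ⟨S, hSA, hScard, hS⟩ := exists_subset_card_eq_of_orthogonal_trivial w _ hact
  have hgS : g = vertexSol κ w S :=
    eq_vertexSol hS fun a ha => (Finset.mem_filter.1 (hSA ha)).2
  refine ⟨S, hSA.trans (Finset.filter_subset _ _), hScard, ?_⟩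
  rw [← hgS]
  exact ⟨hgK, hmax hc⟩

open Matrix in
/-- Sample compression: a direction `c` that is small on the points of `T` can be replaced by one
that is small on the same points and is determined by at most `d` of the points, up to finitely many
choices. The box `|g k| ≤ 2` keeps the polyhedron bounded when the points do not span, and scaling
`c` to a norm in `(1, 2]` keeps the inequalities strict. -/
theorem exists_vertexSol_small {ι : Type*} [Fintype ι] {d : ℕ} {κ : ℝ} (hκ : 0 < κ)
    (v : ι → Fin d → ℝ) (T : Finset ι) {c : Fin d → ℝ} (hc0 : c ≠ 0)
    (hc : ∀ i ∈ T, |c ⬝ᵥ v i| < κ * √(c ⬝ᵥ c)) :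
    ∃ S : Finset ((ι ⊕ Fin d) × Bool), S.card = d ∧
      ∀ i ∈ T, |vertexSol κ (constraintVec κ v) S ⬝ᵥ v i| <
        κ * √(vertexSol κ (constraintVec κ v) S ⬝ᵥ vertexSol κ (constraintVec κ v) S) := by
  classical
  set w := constraintVec κ v with hw
  set n := √(c ⬝ᵥ c) with hn
  have hcc : 0 < c ⬝ᵥ c :=
    lt_of_le_of_ne (Finset.sum_nonneg fun i _ => mul_self_nonneg _)
      fun h => hc0 (dotProduct_self_eq_zero.1 h.symm)
  have hnpos : 0 < n := Real.sqrt_pos.2 hcc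
  have hnsq : n * n = c ⬝ᵥ c := Real.mul_self_sqrt hcc.le
  -- the new norm `r > 1` of `c`, close enough to `1` to keep the constraints of `T`
  obtain ⟨r, ⟨hrT, hr2⟩, hr1⟩ : ∃ r : ℝ, ((∀ i ∈ T, r * (|c ⬝ᵥ v i| / n) < κ) ∧ r < 2) ∧ 1 < r := by
    have e1 : ∀ᶠ r : ℝ in nhdsWithin 1 (Set.Ioi 1), ∀ i ∈ T, r * (|c ⬝ᵥ v i| / n) < κ := by
      rw [Filter.eventually_all_finset]
      intro i hi
      refine (nhdsWithin_le_nhds (a := (1 : ℝ)) (s := Set.Ioi 1)) ?_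
      have h1 : Continuous fun r : ℝ => r * (|c ⬝ᵥ v i| / n) := by fun_prop
      refine h1.continuousAt (x := 1) |>.eventually_lt continuousAt_const ?_
      rw [one_mul, div_lt_iff₀ hnpos]
      exact hc i hi
    have e2 : ∀ᶠ r : ℝ in nhdsWithin 1 (Set.Ioi 1), r < 2 :=
      nhdsWithin_le_nhds (a := (1 : ℝ)) (s := Set.Ioi 1) (eventually_lt_nhds (by norm_num))
    exact ((e1.and e2).and self_mem_nhdsWithin).exists
  set c' : Fin d → ℝ := (r / n) • c with hc'
  have hrn : 0 < r / n := by positivity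
  have hc'c' : c' ⬝ᵥ c' = r ^ 2 := by
    rw [hc', smul_dotProduct, dotProduct_smul, ← hnsq, smul_eq_mul, smul_eq_mul]
    field_simp
  set A : Finset ((ι ⊕ Fin d) × Bool) :=
    Finset.univ.filter fun a => ∀ i, a.1 = Sum.inl i → i ∈ T with hA
  have hmemT : ∀ i ∈ T, ∀ b, ((Sum.inl i, b) : (ι ⊕ Fin d) × Bool) ∈ A := by
    intro i hi b
    simp only [hA, Finset.mem_filter, Finset.mem_univ, true_and]
    rintro j hj
    obtain rfl := Sum.inl.inj hj
    exact hi
  have hmemBox : ∀ k b, ((Sum.inr k, b) : (ι ⊕ Fin d) × Bool) ∈ A := by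
    intro k b
    simp [hA]
  have hbox : ∀ g : Fin d → ℝ, (∀ a ∈ A, w a ⬝ᵥ g ≤ κ) → ∀ k, |g k| ≤ 2 := by
    intro g hg k
    have h1 := hg _ (hmemBox k true)
    have h2 := hg _ (hmemBox k false)
    simp only [hw, constraintVec, neg_dotProduct, single_dotProduct] at h1 h2
    rw [abs_le]
    constructor <;> nlinarith
  have hK : IsCompact {g : Fin d → ℝ | ∀ a ∈ A, w a ⬝ᵥ g ≤ κ} := by
    refine Metric.isCompact_of_isClosed_isBounded ?_ ?_
    · simp only [Set.ofPred_forall]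
      refine isClosed_biInter fun a _ => isClosed_le ?_ continuous_const
      unfold dotProduct
      fun_prop
    · refine (Metric.isBounded_closedBall (x := (0 : Fin d → ℝ)) (r := 2)).subset ?_
      intro g hg
      rw [mem_closedBall_zero_iff, pi_norm_le_iff_of_nonneg (by norm_num)]
      exact hbox g hg
  have hc'K : ∀ a ∈ A, w a ⬝ᵥ c' ≤ κ := by
    rintro ⟨i | k, b⟩ ha
    · have hi : i ∈ T := (Finset.mem_filter.1 ha).2 i rfl
      have h1 : |v i ⬝ᵥ c'| < κ := by
        rw [hc', dotProduct_smul, smul_eq_mul, abs_mul, abs_of_pos hrn, dotProduct_comm]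
        calc r / n * |c ⬝ᵥ v i| = r * (|c ⬝ᵥ v i| / n) := by ring
          _ < κ := hrT i hi
      have h2 := abs_lt.1 h1
      cases b
      · simp only [hw, constraintVec, neg_dotProduct]; linarith
      · simp only [hw, constraintVec]; linarith
    · have h1 : |c' k| ≤ 2 := by
        refine abs_le_of_sq_le_sq ?_ (by norm_num)
        have h3 : c' k * c' k ≤ c' ⬝ᵥ c' :=
          Finset.single_le_sum (f := fun k => c' k * c' k) (fun i _ => mul_self_nonneg _)
            (Finset.mem_univ k)
        nlinarith
      have h2 := abs_le.1 h1
      cases b <;> simp only [hw, constraintVec, neg_dotProduct, single_dotProduct] <;> nlinarith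
  obtain ⟨S, -, hScard, hSK, hSn⟩ := exists_vertex κ w A hK hc'K
  refine ⟨S, hScard, fun i hi => ?_⟩
  set g := vertexSol κ w S
  have h1 : |g ⬝ᵥ v i| ≤ κ := by
    have h1 := hSK _ (hmemT i hi true)
    have h2 := hSK _ (hmemT i hi false)
    simp only [hw, constraintVec, neg_dotProduct] at h1 h2
    rw [dotProduct_comm, abs_le]
    constructor <;> linarith
  have h2 : 1 < √(g ⬝ᵥ g) := by
    rw [Real.lt_sqrt (by norm_num)]
    rw [hc'c'] at hSn
    nlinarith
  nlinarith

open Matrix in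
theorem measurable_vertexSol {ι : Type*} [Countable ι] {d : ℕ} (κ : ℝ) (S : Finset ι) :
    Measurable fun w : ι → Fin d → ℝ => vertexSol κ w S := by
  have hG : Continuous fun w : ι → Fin d → ℝ => ∑ a ∈ S, vecMulVec (w a) (w a) :=
    continuous_finsetSum _ fun a _ => (continuous_apply a).matrix_vecMulVec (continuous_apply a)
  have hb : Continuous fun w : ι → Fin d → ℝ => κ • ∑ a ∈ S, w a := by fun_prop
  have hdet : Measurable fun w : ι → Fin d → ℝ => (∑ a ∈ S, vecMulVec (w a) (w a)).det :=
    hG.matrix_det.measurable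
  have hadj : Measurable fun w : ι → Fin d → ℝ =>
      (∑ a ∈ S, vecMulVec (w a) (w a)).adjugate *ᵥ (κ • ∑ a ∈ S, w a) :=
    (hG.matrix_adjugate.matrix_mulVec hb).measurable
  have : (fun w : ι → Fin d → ℝ => vertexSol κ w S) = fun w =>
      ((∑ a ∈ S, vecMulVec (w a) (w a)).det)⁻¹ •
        ((∑ a ∈ S, vecMulVec (w a) (w a)).adjugate *ᵥ (κ • ∑ a ∈ S, w a)) := by
    funext w
    rw [vertexSol, Matrix.inv_def, Matrix.smul_mulVec, Ring.inverse_eq_inv']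
  rw [this]
  exact hdet.inv.smul hadj

theorem measurable_constraintVec {ι : Type*} {d : ℕ} (κ : ℝ) :
    Measurable (constraintVec κ : (ι → Fin d → ℝ) → (ι ⊕ Fin d) × Bool → Fin d → ℝ) := by
  refine measurable_pi_lambda _ ?_
  rintro ⟨i | k, _ | _⟩ <;> simp only [constraintVec] <;> fun_prop

/-- The points of the sample on which a set of signed constraints depends. -/
def pointSupport {ι : Type*} [DecidableEq ι] {d : ℕ} (S : Finset ((ι ⊕ Fin d) × Bool)) :
    Finset ι :=
  S.biUnion fun a => a.1.elim (fun i => {i}) (fun _ => ∅)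

theorem card_pointSupport_le {ι : Type*} [DecidableEq ι] {d : ℕ}
    (S : Finset ((ι ⊕ Fin d) × Bool)) : (pointSupport S).card ≤ S.card := by
  refine (Finset.card_biUnion_le_card_mul _ _ 1 ?_).trans (by simp)
  rintro ⟨i | k, b⟩ _ <;> simp

theorem vertexSol_constraintVec_congr {ι : Type*} [DecidableEq ι] {d : ℕ} (κ : ℝ)
    (S : Finset ((ι ⊕ Fin d) × Bool)) {v v' : ι → Fin d → ℝ}
    (h : ∀ i ∈ pointSupport S, v i = v' i) :
    vertexSol κ (constraintVec κ v) S = vertexSol κ (constraintVec κ v') S := by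
  have key : ∀ a ∈ S, constraintVec κ v a = constraintVec κ v' a := by
    rintro ⟨i | k, b⟩ ha
    · have hi : i ∈ pointSupport S := Finset.mem_biUnion.2 ⟨_, ha, by simp⟩
      cases b <;> simp [constraintVec, h i hi]
    · cases b <;> rfl
  unfold vertexSol
  rw [Finset.sum_congr rfl key, Finset.sum_congr rfl fun a ha => by rw [key a ha]]

/-! ### A uniform small-ball estimate -/

/-- Conditional independence in integrated form: if `g` depends only on the coordinates in `s`,
then given those coordinates the others are still independent with law `μ`. -/
theorem lintegral_prod_compl_le {ι E G : Type*} [Fintype ι] [DecidableEq ι] [MeasurableSpace E]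
    [MeasurableSpace G] (μ : Measure E) [IsProbabilityMeasure μ] (s : Finset ι)
    {g : (ι → E) → G} (hg : Measurable g)
    (hdep : ∀ v v' : ι → E, (∀ i ∈ s, v i = v' i) → g v = g v')
    {φ : G → E → ENNReal} (hφ : Measurable (Function.uncurry φ)) {q : ENNReal}
    (hq : ∀ c, ∫⁻ y, φ c y ∂μ ≤ q) :
    ∫⁻ v, ∏ i ∈ sᶜ, φ (g v) (v i) ∂(Measure.pi fun _ : ι => μ) ≤ q ^ sᶜ.card := by
  have hmp := measurePreserving_piEquivPiSubtypeProd (fun _ : ι => μ) (fun i => i ∈ s)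
  set e := MeasurableEquiv.piEquivPiSubtypeProd (fun _ : ι => E) (fun i => i ∈ s) with he
  have hF : Measurable fun v : ι → E => ∏ i ∈ sᶜ, φ (g v) (v i) :=
    Finset.measurable_fun_prod _ fun i _ => hφ.comp (hg.prodMk (measurable_pi_apply i))
  rw [← hmp.symm.lintegral_comp hF, lintegral_prod (fun z => ∏ i ∈ sᶜ, φ (g (e.symm z)) (e.symm z i))
    (hF.comp e.symm.measurable).aemeasurable]
  obtain ⟨y₀⟩ : Nonempty E := nonempty_of_isProbabilityMeasure μ
  have hinner : ∀ u : ({i // i ∈ s} → E),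
      ∫⁻ z, ∏ i ∈ sᶜ, φ (g (e.symm (u, z))) (e.symm (u, z) i)
        ∂(Measure.pi fun _ : {i // i ∉ s} => μ) ≤ q ^ sᶜ.card := by
    intro u
    set c := g (e.symm (u, fun _ => y₀))
    have hc : ∀ z, g (e.symm (u, z)) = c := fun z =>
      hdep _ _ fun i hi => by
        simp [he, MeasurableEquiv.piEquivPiSubtypeProd, Equiv.piEquivPiSubtypeProd, hi]
    have hprod : ∀ z, ∏ i ∈ sᶜ, φ (g (e.symm (u, z))) (e.symm (u, z) i) =
        ∏ i : {i // i ∉ s}, φ c (z i) := by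
      intro z
      rw [hc, ← Finset.prod_subtype_of_mem (p := fun i => i ∉ s)
        (fun i => φ c (e.symm (u, z) i)) (fun i hi => Finset.mem_compl.1 hi)]
      have : Finset.subtype (fun i => i ∉ s) sᶜ = Finset.univ := by
        ext i; simpa using i.2
      rw [this]
      refine Finset.prod_congr rfl fun i _ => ?_
      congr 1
      simp [he, MeasurableEquiv.piEquivPiSubtypeProd, Equiv.piEquivPiSubtypeProd, i.2]
    simp_rw [hprod]
    have hφc : Measurable (φ c) := hφ.comp measurable_prodMk_left
    rw [lintegral_prod_eq_prod_lintegral_of_indepFun Finset.univ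
      (fun i (z : {i // i ∉ s} → E) => φ c (z i))
      (iIndepFun_pi (X := fun _ => φ c) fun _ => hφc.aemeasurable)
      (fun i => hφc.comp (measurable_pi_apply i))]
    calc ∏ i : {i // i ∉ s}, ∫⁻ z, φ c (z i) ∂(Measure.pi fun _ : {i // i ∉ s} => μ)
        ≤ ∏ _i : {i // i ∉ s}, q := by
          refine Finset.prod_le_prod' fun i _ => ?_
          rw [(measurePreserving_eval (fun _ : {i // i ∉ s} => μ) i).lintegral_comp hφc]
          exact hq c
      _ = q ^ sᶜ.card := by
          rw [Finset.prod_const, Finset.card_univ, Fintype.card_subtype]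
          congr 2
          ext; simp
  refine (lintegral_mono hinner).trans ?_
  simp

open Classical in
/-- Chernoff bound with exponential parameter `1` for the number of sample points in a random set
that depends on the sample only through the coordinates in `s`. -/
theorem measure_card_lt_le {ι E G : Type*} [Fintype ι] [DecidableEq ι] [MeasurableSpace E]
    [MeasurableSpace G] (μ : Measure E) [IsProbabilityMeasure μ] (s : Finset ι)
    {g : (ι → E) → G} (hg : Measurable g)
    (hdep : ∀ v v' : ι → E, (∀ i ∈ s, v i = v' i) → g v = g v')
    {A : G → Set E} (hA : MeasurableSet {p : G × E | p.2 ∈ A p.1}) {β : ℝ}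
    (hβ : ∀ c, β ≤ μ.real (A c)) (m : ℝ) :
    (Measure.pi fun _ : ι => μ) {v | ((Finset.univ.filter fun i => v i ∈ A (g v)).card : ℝ) < m} ≤
      ENNReal.ofReal (Real.exp (m - sᶜ.card * (β * (1 - Real.exp (-1))))) := by
  set φ : G → E → ENNReal := fun c y =>
    if y ∈ A c then ENNReal.ofReal (Real.exp (-1)) else 1 with hφdef
  have hφ : Measurable (Function.uncurry φ) :=
    Measurable.ite hA measurable_const measurable_const
  have hq : ∀ c, ∫⁻ y, φ c y ∂μ ≤ ENNReal.ofReal (Real.exp (-(β * (1 - Real.exp (-1))))) := by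
    intro c
    have hAc : MeasurableSet (A c) := measurable_prodMk_left hA
    have h1 : ∫⁻ y, φ c y ∂μ =
        ENNReal.ofReal (Real.exp (-1)) * μ (A c) + μ (A c)ᶜ := by
      rw [← lintegral_add_compl _ hAc]
      congr 1
      · rw [setLIntegral_congr_fun hAc (g := fun _ => ENNReal.ofReal (Real.exp (-1)))
          (fun y hy => by simp only [hφdef]; rw [if_pos hy])]
        simp
      · rw [setLIntegral_congr_fun hAc.compl (g := fun _ => 1)
          (fun y hy => by simp only [hφdef]; rw [if_neg hy])]
        simp
    rw [h1, ← ofReal_measureReal, ← ofReal_measureReal (s := (A c)ᶜ),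
      ← ENNReal.ofReal_mul (Real.exp_pos _).le,
      ← ENNReal.ofReal_add (by positivity) measureReal_nonneg]
    refine ENNReal.ofReal_le_ofReal ?_
    rw [probReal_compl_eq_one_sub hAc]
    have h2 : 0 < 1 - Real.exp (-1) := by
      have := Real.exp_neg_one_lt_d9; linarith
    have h3 := Real.add_one_le_exp (-(β * (1 - Real.exp (-1))))
    nlinarith [hβ c]
  have hF : Measurable fun v : ι → E => ∏ i ∈ sᶜ, φ (g v) (v i) :=
    Finset.measurable_fun_prod _ fun i _ => hφ.comp (hg.prodMk (measurable_pi_apply i))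
  have hsub : {v : ι → E | ((Finset.univ.filter fun i => v i ∈ A (g v)).card : ℝ) < m} ⊆
      {v | ENNReal.ofReal (Real.exp (-m)) ≤ ∏ i ∈ sᶜ, φ (g v) (v i)} := by
    intro v hv
    have hv : ((Finset.univ.filter fun i => v i ∈ A (g v)).card : ℝ) < m := hv
    have hcard : (((sᶜ).filter fun i => v i ∈ A (g v)).card : ℝ) ≤
        (Finset.univ.filter fun i => v i ∈ A (g v)).card := by
      exact_mod_cast Finset.card_le_card (Finset.filter_subset_filter _ (Finset.subset_univ _))
    show _ ≤ ∏ i ∈ sᶜ, φ (g v) (v i)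
    simp only [hφdef]
    rw [Finset.prod_ite, Finset.prod_const, Finset.prod_const_one, mul_one,
      ← ENNReal.ofReal_pow (Real.exp_pos _).le, ← Real.exp_nat_mul]
    refine ENNReal.ofReal_le_ofReal (Real.exp_le_exp.2 ?_)
    linarith
  calc _ ≤ _ := measure_mono hsub
    _ ≤ (∫⁻ v, ∏ i ∈ sᶜ, φ (g v) (v i) ∂(Measure.pi fun _ : ι => μ)) /
          ENNReal.ofReal (Real.exp (-m)) :=
        meas_ge_le_lintegral_div hF.aemeasurable (by simp [Real.exp_pos]) ENNReal.ofReal_ne_top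
    _ ≤ ENNReal.ofReal (Real.exp (-(β * (1 - Real.exp (-1))))) ^ sᶜ.card /
          ENNReal.ofReal (Real.exp (-m)) := by
        gcongr
        exact lintegral_prod_compl_le μ s hg hdep hφ hq
    _ = _ := by
        rw [← ENNReal.ofReal_pow (Real.exp_pos _).le, ← Real.exp_nat_mul,
          ← ENNReal.ofReal_div_of_pos (Real.exp_pos _), ← Real.exp_sub]
        congr 2
        ring

/-- The number of candidate vertices costs much less than the Chernoff bound gains: with
`r = N / d`, its logarithm is at most `d * log (4 e r) ≤ d * (4 √r + 1)`, while
`β N / 4 = d * (β r / 4) ≥ d * (100 √r)`. -/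
theorem choose_le_exp {d N : ℕ} {β : ℝ} (hβ : 0 < β) (hβ1 : β ≤ 1)
    (hN : (400 : ℝ) ^ 2 * d / β ^ 2 ≤ N) :
    (((N + d) * 2).choose d : ℝ) ≤ Real.exp (β * N / 4) := by
  rcases Nat.eq_zero_or_pos d with rfl | hd
  · simp only [Nat.choose_zero_right, Nat.cast_one]
    exact Real.one_le_exp (by positivity)
  have hd' : (0 : ℝ) < d := by exact_mod_cast hd
  have hN' : (400 : ℝ) ^ 2 * d ≤ N * β ^ 2 := (div_le_iff₀ (by positivity)).1 hN
  have hNd : (d : ℝ) ≤ N := by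
    have : (N : ℝ) * β ^ 2 ≤ N * 1 :=
      mul_le_mul_of_nonneg_left (by nlinarith) (Nat.cast_nonneg _)
    linarith
  have hNpos : (0 : ℝ) < N := by linarith
  set t := √((N : ℝ) / d) with ht
  have htsq : t ^ 2 = N / d := Real.sq_sqrt (by positivity)
  have htpos : 0 < t := Real.sqrt_pos.2 (by positivity)
  have hN2 : (N : ℝ) = t ^ 2 * d := by rw [htsq]; field_simp
  have htβ : 400 ≤ t * β := by
    have : (400 : ℝ) ^ 2 ≤ (t * β) ^ 2 := by
      rw [mul_pow, htsq, div_mul_eq_mul_div, le_div_iff₀ hd']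
      exact hN'
    exact le_of_sq_le_sq this (by positivity)
  -- `4 t ^ 2 ≤ exp (4 * t)`, from the square of `2 t ≤ exp (2 t)`
  have hexp : 4 * t ^ 2 ≤ Real.exp (4 * t) := by
    have h1 := Real.add_one_le_exp (2 * t)
    have h2 : Real.exp (4 * t) = Real.exp (2 * t) ^ 2 := by
      rw [← Real.exp_nat_mul]; congr 1; push_cast; ring
    rw [h2]
    nlinarith
  have hfact : (d : ℝ) ^ d / d.factorial ≤ Real.exp d :=
    Real.pow_div_factorial_le_exp _ hd'.le d
  calc (((N + d) * 2).choose d : ℝ)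
      ≤ (((N + d) * 2 : ℕ) : ℝ) ^ d / d.factorial := Nat.choose_le_pow_div d _
    _ ≤ (4 * t ^ 2 * d) ^ d / d.factorial := by
        gcongr
        push_cast
        linarith
    _ = (4 * t ^ 2) ^ d * (d ^ d / d.factorial) := by rw [mul_pow]; ring
    _ ≤ Real.exp (4 * t) ^ d * Real.exp d := by gcongr
    _ = Real.exp (d * (4 * t + 1)) := by
        rw [← Real.exp_nat_mul, ← Real.exp_add]; congr 1; ring
    _ ≤ Real.exp (β * N / 4) := by
        refine Real.exp_le_exp.2 ?_
        rw [hN2]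
        have h1 : 100 * t ≤ β * t ^ 2 / 4 := by nlinarith
        have h2 : 1 ≤ t := by nlinarith
        have h3 : 4 * t + 1 ≤ β * t ^ 2 / 4 := by linarith
        nlinarith

open Matrix Classical in
/-- Uniform small-ball estimate: off an event of probability at most `exp (-β² N / 4)`, every
direction `c` is large on at least `β N / 8` of the sample points. Sample compression reduces this
to a union bound over finitely many vertices. -/
theorem exists_uniform_smallBall {d : ℕ} (μ : Measure (Fin d → ℝ)) [IsProbabilityMeasure μ]
    {κ β : ℝ} (hκ : 0 < κ) (hβ : 0 < β)
    (h : ∀ c : Fin d → ℝ, β ≤ μ.real {y | κ * √(c ⬝ᵥ c) ≤ |c ⬝ᵥ y|})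
    {N : ℕ} (hN : (400 : ℝ) ^ 2 * d / β ^ 2 ≤ N) :
    ∃ U : Set (Fin N → Fin d → ℝ), MeasurableSet U ∧
      (Measure.pi fun _ : Fin N => μ) U ≤ ENNReal.ofReal (Real.exp (-(β ^ 2 * N / 4))) ∧
      ∀ v ∉ U, ∀ c : Fin d → ℝ,
        β * N / 8 ≤ (Finset.univ.filter fun i => κ * √(c ⬝ᵥ c) ≤ |c ⬝ᵥ v i|).card := by
  have hβ1 : β ≤ 1 := (h 0).trans measureReal_le_one
  set A : (Fin d → ℝ) → Set (Fin d → ℝ) := fun c => {y | κ * √(c ⬝ᵥ c) ≤ |c ⬝ᵥ y|} with hAdef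
  have hA : MeasurableSet {p : (Fin d → ℝ) × (Fin d → ℝ) | p.2 ∈ A p.1} := by
    refine measurableSet_le (f := fun p : (Fin d → ℝ) × (Fin d → ℝ) => κ * √(p.1 ⬝ᵥ p.1))
      (g := fun p => |p.1 ⬝ᵥ p.2|) ?_ ?_
    · unfold dotProduct; fun_prop
    · unfold dotProduct; fun_prop
  set g : Finset ((Fin N ⊕ Fin d) × Bool) → (Fin N → Fin d → ℝ) → Fin d → ℝ :=
    fun S v => vertexSol κ (constraintVec κ v) S with hgdef
  set B : Finset ((Fin N ⊕ Fin d) × Bool) → Set (Fin N → Fin d → ℝ) := fun S =>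
    {v | ((Finset.univ.filter fun i => v i ∈ A (g S v)).card : ℝ) < β * N / 8} with hBdef
  set I := (Finset.univ : Finset ((Fin N ⊕ Fin d) × Bool)).powersetCard d with hI
  have hIcard : I.card = ((N + d) * 2).choose d := by
    simp [hI, Finset.card_powersetCard]
  have hBle : ∀ S ∈ I, (Measure.pi fun _ : Fin N => μ) (B S) ≤ ENNReal.ofReal
      (Real.exp (β * N / 8 - (N - d) * (β * (1 - Real.exp (-1))))) := by
    intro S hS
    refine (measure_card_lt_le μ (pointSupport S)
      ((measurable_vertexSol κ S).comp (measurable_constraintVec κ))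
      (fun v v' hv => vertexSol_constraintVec_congr κ S hv) hA h _).trans ?_
    refine ENNReal.ofReal_le_ofReal (Real.exp_le_exp.2 ?_)
    have h1 : ((N : ℝ) - d) ≤ (pointSupport S)ᶜ.card := by
      have h2 := card_pointSupport_le S
      have h3 := Finset.card_add_card_compl (pointSupport S)
      rw [(Finset.mem_powersetCard.1 hS).2] at h2
      rw [Fintype.card_fin] at h3
      have h4 : N ≤ (pointSupport S)ᶜ.card + d := by omega
      have : (N : ℝ) ≤ (pointSupport S)ᶜ.card + d := by exact_mod_cast h4
      linarith
    have h2 : 0 < 1 - Real.exp (-1) := by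
      have := Real.exp_neg_one_lt_d9; linarith
    have := mul_le_mul_of_nonneg_right h1 (mul_pos hβ h2).le
    linarith
  refine ⟨toMeasurable (Measure.pi fun _ : Fin N => μ) (⋃ S ∈ I, B S),
    measurableSet_toMeasurable _ _, ?_, ?_⟩
  · rw [measure_toMeasurable]
    calc _ ≤ ∑ S ∈ I, (Measure.pi fun _ : Fin N => μ) (B S) := measure_biUnion_finset_le _ _
      _ ≤ ∑ _S ∈ I, ENNReal.ofReal
            (Real.exp (β * N / 8 - (N - d) * (β * (1 - Real.exp (-1))))) :=
          Finset.sum_le_sum hBle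
      _ = ENNReal.ofReal (((N + d) * 2).choose d *
            Real.exp (β * N / 8 - (N - d) * (β * (1 - Real.exp (-1))))) := by
          rw [Finset.sum_const, hIcard, nsmul_eq_mul, ENNReal.ofReal_mul (Nat.cast_nonneg _),
            ENNReal.ofReal_natCast]
      _ ≤ ENNReal.ofReal (Real.exp (β * N / 4) *
            Real.exp (β * N / 8 - (N - d) * (β * (1 - Real.exp (-1))))) := by
          gcongr
          exact choose_le_exp hβ hβ1 hN
      _ ≤ _ := by
          rw [← Real.exp_add]
          refine ENNReal.ofReal_le_ofReal (Real.exp_le_exp.2 ?_)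
          -- per unit of `β N`: `1/4` for the union, `1/8` for the count, at most `-0.629` for
          -- the Chernoff gain, so the total is below `-1/4`, and `β² ≤ β`
          have he : Real.exp (-1) < 0.37 := by
            have := Real.exp_neg_one_lt_d9; linarith
          have hN' : (400 : ℝ) ^ 2 * d ≤ N * β ^ 2 := (div_le_iff₀ (by positivity)).1 hN
          have hNn : (0 : ℝ) ≤ N := Nat.cast_nonneg _
          have hb2 : β ^ 2 * N ≤ β * N := mul_le_mul_of_nonneg_right (by nlinarith) hNn
          have hb3 : β * N ≤ N := by nlinarith
          have hdN : (d : ℝ) ≤ N / 160000 := by linarith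
          have hNd : (0 : ℝ) ≤ N - d := by linarith
          have h5 : (N - d) * (β * 0.63) ≤ (N - d) * (β * (1 - Real.exp (-1))) := by
            refine mul_le_mul_of_nonneg_left ?_ hNd
            exact mul_le_mul_of_nonneg_left (by linarith) hβ.le
          have h6 : β * d ≤ β * (N / 160000) := mul_le_mul_of_nonneg_left hdN hβ.le
          have h7 : 0 ≤ β * N := mul_nonneg hβ.le hNn
          nlinarith
  · -- the zero direction meets every count; any other one is compressed to a vertex
    intro v hv c
    by_contra hlt
    refine hv (subset_toMeasurable _ _ ?_)
    have hc0 : c ≠ 0 := by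
      rintro rfl
      refine hlt ?_
      have : (Finset.univ.filter fun i : Fin N =>
          κ * √((0 : Fin d → ℝ) ⬝ᵥ 0) ≤ |(0 : Fin d → ℝ) ⬝ᵥ v i|) = Finset.univ := by
        simp
      rw [this, Finset.card_univ, Fintype.card_fin]
      have hNn : (0 : ℝ) ≤ N := Nat.cast_nonneg _
      nlinarith
    obtain ⟨S, hS, hsmall⟩ := exists_vertexSol_small hκ v
      (Finset.univ.filter fun i => |c ⬝ᵥ v i| < κ * √(c ⬝ᵥ c)) hc0
      (fun i hi => (Finset.mem_filter.1 hi).2)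
    refine Set.mem_biUnion (x := S) (by simp [hI, Finset.mem_powersetCard, hS]) ?_
    show ((Finset.univ.filter fun i => v i ∈ A (g S v)).card : ℝ) < β * N / 8
    refine lt_of_le_of_lt ?_ (not_le.1 hlt)
    refine Nat.cast_le.2 (Finset.card_le_card fun i hi => ?_)
    rw [Finset.mem_filter] at hi ⊢
    refine ⟨hi.1, ?_⟩
    by_contra hnot
    have := hsmall i (by simpa using hnot)
    exact absurd hi.2 (not_le.2 this)

/-! ### Orthonormal coordinates and the oracle -/

theorem measurable_of_mem_dictSpan {𝒳 : Type*} [MeasurableSpace 𝒳] {M : ℕ} {f : Fin M → 𝒳 → ℝ}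
    (hf : ∀ j, Measurable (f j)) {h : 𝒳 → ℝ} (hh : h ∈ dictSpan f) : Measurable h := by
  refine Submodule.span_induction (p := fun y _ => Measurable y) ?_ measurable_const
    (fun y z _ _ hy hz => hy.add hz) (fun r y _ hy => hy.const_smul r) hh
  rintro _ ⟨j, rfl⟩
  exact hf j

theorem memLp_of_mem_dictSpan {Ω 𝒳 : Type*} [MeasurableSpace Ω] {P : Measure Ω} {X : Ω → 𝒳} {M : ℕ}
    {f : Fin M → 𝒳 → ℝ} (hf2 : ∀ j, MemLp (fun ω => f j (X ω)) 2 P) {h : 𝒳 → ℝ}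
    (hh : h ∈ dictSpan f) : MemLp (fun ω => h (X ω)) 2 P := by
  refine Submodule.span_induction (p := fun y _ => MemLp (fun ω => y (X ω)) 2 P) ?_ ?_ ?_ ?_ hh
  · rintro _ ⟨j, rfl⟩
    exact hf2 j
  · exact MemLp.zero'
  · intro y z _ _ hy hz
    exact hy.add hz
  · intro r y _ hy
    exact hy.const_smul r

open Matrix in
/-- Orthonormal coordinates for the span: an `L₂`-orthonormal family `e` of at most `M` functions of
the span such that, on a single set `D` of full measure, every function of the span is a linear
combination of `e`. Functions of the span with zero norm need not vanish identically, hence `D`. -/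
theorem exists_orthonormal_coordinates {Ω 𝒳 : Type*} [MeasurableSpace Ω] [MeasurableSpace 𝒳]
    (P : Measure Ω) {X : Ω → 𝒳} {M : ℕ} {f : Fin M → 𝒳 → ℝ}
    (hf : ∀ j, Measurable (f j)) (hf2 : ∀ j, MemLp (fun ω => f j (X ω)) 2 P) :
    ∃ d ≤ M, ∃ e : 𝒳 → Fin d → ℝ, (∀ k, (fun x => e x k) ∈ dictSpan f) ∧
      (∀ k l, ∫ ω, e (X ω) k * e (X ω) l ∂P = if k = l then 1 else 0) ∧
      ∃ D : Set 𝒳, MeasurableSet D ∧ (∀ᵐ ω ∂P, X ω ∈ D) ∧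
        ∀ h ∈ dictSpan f, ∃ c : Fin d → ℝ, ∀ x ∈ D, h x = c ⬝ᵥ e x := by
  set F : Fin M → Lp ℝ 2 P := fun j => (hf2 j).toLp _ with hF
  have hFae : ∀ a : Fin M → ℝ,
      ((∑ j, a j • F j : Lp ℝ 2 P) : Ω → ℝ) =ᵐ[P] fun ω => ∑ j, a j * f j (X ω) := by
    intro a
    have h1 := Lp.coeFn_finsetSum (E := ℝ) (p := 2) (μ := P) Finset.univ fun j => a j • F j
    have h2 : ∀ᵐ ω ∂P, ∀ j, (a j • F j : Lp ℝ 2 P) ω = a j * f j (X ω) := by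
      rw [ae_all_iff]
      intro j
      filter_upwards [Lp.coeFn_smul (a j) (F j), (hf2 j).coeFn_toLp] with ω h3 h4
      rw [h3, Pi.smul_apply, h4, smul_eq_mul]
    filter_upwards [h1, h2] with ω h3 h4
    rw [h3, Finset.sum_apply]
    exact Finset.sum_congr rfl fun j _ => h4 j
  set W : Submodule ℝ (Lp ℝ 2 P) := Submodule.span ℝ (Set.range F) with hW
  have : FiniteDimensional ℝ W := FiniteDimensional.span_of_finite ℝ (Set.finite_range F)
  set b := stdOrthonormalBasis ℝ W with hb
  have hbF : ∀ k, ∃ a : Fin M → ℝ, ∑ j, a j • F j = (b k : Lp ℝ 2 P) := fun k =>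
    (Submodule.mem_span_range_iff_exists_fun ℝ).1 (b k).2
  choose a ha using hbF
  set e : 𝒳 → Fin (Module.finrank ℝ W) → ℝ := fun x k => ∑ j, a k j * f j x with he
  have hebk : ∀ k, ((b k : Lp ℝ 2 P) : Ω → ℝ) =ᵐ[P] fun ω => e (X ω) k := by
    intro k
    rw [← ha k]
    exact hFae (a k)
  have hespan : ∀ k, (fun x => e x k) ∈ dictSpan f := by
    intro k
    have : (fun x => e x k) = ∑ j, a k j • f j := by
      ext x; simp [he]
    rw [this]
    exact Submodule.sum_mem _ fun j _ =>
      Submodule.smul_mem _ _ (Submodule.subset_span ⟨j, rfl⟩)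
  have hemeas : ∀ k, Measurable fun x => e x k := fun k =>
    measurable_of_mem_dictSpan hf (hespan k)
  set α : Fin M → Fin (Module.finrank ℝ W) → ℝ := fun j k =>
    b.repr ⟨F j, Submodule.subset_span ⟨j, rfl⟩⟩ k with hα
  refine ⟨Module.finrank ℝ W, ?_, e, hespan, ?_,
    {x | ∀ j, f j x = α j ⬝ᵥ e x}, ?_, ?_, ?_⟩
  · exact (finrank_range_le_card (R := ℝ) F).trans_eq (by simp)
  · intro k l
    have h1 : inner ℝ (b l : Lp ℝ 2 P) (b k : Lp ℝ 2 P) = if l = k then (1 : ℝ) else 0 := by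
      rw [← Submodule.coe_inner]
      exact orthonormal_iff_ite.1 b.orthonormal l k
    rw [L2.inner_def] at h1
    rw [if_congr (eq_comm (a := k) (b := l)) rfl rfl, ← h1]
    refine integral_congr_ae ?_
    filter_upwards [hebk k, hebk l] with ω h2 h3
    rw [h2, h3]
    simp
  · rw [Set.ofPred_forall]
    refine MeasurableSet.iInter fun j => measurableSet_eq_fun (hf j) ?_
    unfold dotProduct
    exact Finset.measurable_fun_sum _ fun k _ => (hemeas k).const_mul _
  · have h0 : ∀ᵐ ω ∂P, ∀ j, f j (X ω) = α j ⬝ᵥ e (X ω) := by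
      rw [ae_all_iff]
      intro j
      have h1 : (∑ k, α j k • (b k : Lp ℝ 2 P)) = F j := by
        have := congrArg (Submodule.subtype W)
          (b.sum_repr ⟨F j, Submodule.subset_span ⟨j, rfl⟩⟩)
        simpa using this
      have h2 := Lp.coeFn_finsetSum (E := ℝ) (p := 2) (μ := P) Finset.univ
        fun k => α j k • (b k : Lp ℝ 2 P)
      have h3 : ∀ᵐ ω ∂P, ∀ k, (α j k • (b k : Lp ℝ 2 P) : Lp ℝ 2 P) ω = α j k * e (X ω) k := by
        rw [ae_all_iff]
        intro k
        filter_upwards [Lp.coeFn_smul (α j k) (b k : Lp ℝ 2 P), hebk k] with ω h4 h5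
        rw [h4, Pi.smul_apply, h5, smul_eq_mul]
      rw [h1] at h2
      filter_upwards [h2, h3, (hf2 j).coeFn_toLp] with ω h4 h5 h6
      rw [← h6]
      refine h4.trans ?_
      rw [Finset.sum_apply]
      exact Finset.sum_congr rfl fun k _ => h5 k
    exact h0
  · intro h hh
    refine Submodule.span_induction
      (p := fun y _ => ∃ c : Fin _ → ℝ, ∀ x ∈ {x | ∀ j, f j x = α j ⬝ᵥ e x}, y x = c ⬝ᵥ e x)
      ?_ ?_ ?_ ?_ hh
    · rintro _ ⟨j, rfl⟩
      exact ⟨α j, fun x hx => hx j⟩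
    · exact ⟨0, fun x _ => by simp⟩
    · rintro y z _ _ ⟨c, hc⟩ ⟨c', hc'⟩
      exact ⟨c + c', fun x hx => by rw [add_dotProduct, Pi.add_apply, hc x hx, hc' x hx]⟩
    · rintro r y _ ⟨c, hc⟩
      exact ⟨r • c, fun x hx => by rw [smul_dotProduct, Pi.smul_apply, hc x hx]⟩

open Matrix in
theorem integral_dotProduct_sq {Ω : Type*} [MeasurableSpace Ω] {P : Measure Ω} {d : ℕ}
    {V : Ω → Fin d → ℝ} (hV : ∀ k, MemLp (fun ω => V ω k) 2 P)
    (horth : ∀ k l, ∫ ω, V ω k * V ω l ∂P = if k = l then 1 else 0) (c : Fin d → ℝ) :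
    ∫ ω, (c ⬝ᵥ V ω) ^ 2 ∂P = c ⬝ᵥ c := by
  have hint : ∀ k l, Integrable (fun ω => c k * c l * (V ω k * V ω l)) P := fun k l =>
    ((hV k).integrable_mul (hV l)).const_mul _
  have h1 : ∀ ω, (c ⬝ᵥ V ω) ^ 2 = ∑ k, ∑ l, c k * c l * (V ω k * V ω l) := by
    intro ω
    rw [sq, dotProduct, Finset.sum_mul_sum]
    refine Finset.sum_congr rfl fun k _ => Finset.sum_congr rfl fun l _ => by ring
  simp_rw [h1]
  rw [integral_finsetSum _ fun k _ => integrable_finsetSum _ fun l _ => hint k l]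
  refine Finset.sum_congr rfl fun k _ => ?_
  rw [integral_finsetSum _ fun l _ => hint k l]
  simp_rw [integral_const_mul, horth]
  simp

theorem risk_add {Ω 𝒳 : Type*} [MeasurableSpace Ω] {P : Measure Ω} {X : Ω → 𝒳} {Y : Ω → ℝ}
    {g h : 𝒳 → ℝ} (hg : MemLp (fun ω => Y ω - g (X ω)) 2 P) (hh : MemLp (fun ω => h (X ω)) 2 P) :
    risk P X Y (g + h) =
      risk P X Y g - 2 * ∫ ω, (Y ω - g (X ω)) * h (X ω) ∂P + ∫ ω, h (X ω) ^ 2 ∂P := by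
  have h1 : Integrable (fun ω => (Y ω - g (X ω)) ^ 2) P := hg.integrable_sq
  have h2 : Integrable (fun ω => 2 * ((Y ω - g (X ω)) * h (X ω))) P :=
    (hg.integrable_mul hh).const_mul 2
  have h3 : Integrable (fun ω => h (X ω) ^ 2) P := hh.integrable_sq
  unfold risk
  have h4 := integral_add (h1.sub h2) h3
  simp only [Pi.sub_apply] at h4
  rw [← integral_const_mul, ← integral_sub h1 h2, ← h4]
  refine integral_congr_ae (Filter.Eventually.of_forall fun ω => ?_)
  simp only [Pi.add_apply]
  ring

/-- First-order optimality: the noise is orthogonal to the span. -/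
theorem integral_residual_mul_eq_zero {Ω 𝒳 : Type*} [MeasurableSpace Ω] {P : Measure Ω}
    {X : Ω → 𝒳} {Y : Ω → ℝ} {V : Submodule ℝ (𝒳 → ℝ)} {g h : 𝒳 → ℝ}
    (hmin : IsArgmin (risk P X Y) V g) (hh : h ∈ V)
    (hg2 : MemLp (fun ω => Y ω - g (X ω)) 2 P) (hh2 : MemLp (fun ω => h (X ω)) 2 P) :
    ∫ ω, (Y ω - g (X ω)) * h (X ω) ∂P = 0 := by
  set B := ∫ ω, (Y ω - g (X ω)) * h (X ω) ∂P with hB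
  have key : ∀ t : ℝ, 0 ≤ (∫ ω, h (X ω) ^ 2 ∂P) * (t * t) + (-2 * B) * t + 0 := by
    intro t
    have h1 := hmin.2 (g + t • h) (V.add_mem hmin.1 (V.smul_mem t hh))
    rw [risk_add hg2 (hh2.const_smul t)] at h1
    have h2 : ∫ ω, (Y ω - g (X ω)) * (t • h) (X ω) ∂P = t * B := by
      rw [hB, ← integral_const_mul]
      refine integral_congr_ae (Filter.Eventually.of_forall fun ω => ?_)
      simp only [Pi.smul_apply, smul_eq_mul]; ring
    have h3 : ∫ ω, (t • h) (X ω) ^ 2 ∂P = t ^ 2 * ∫ ω, h (X ω) ^ 2 ∂P := by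
      rw [← integral_const_mul]
      refine integral_congr_ae (Filter.Eventually.of_forall fun ω => ?_)
      simp only [Pi.smul_apply, smul_eq_mul]; ring
    rw [h2, h3] at h1
    linarith
  have := discrim_le_zero key
  rw [discrim] at this
  nlinarith

theorem sInf_image_risk_eq {𝒳 : Type*} {R : (𝒳 → ℝ) → ℝ} {V : Submodule ℝ (𝒳 → ℝ)} {g : 𝒳 → ℝ}
    (hmin : IsArgmin R V g) : sInf (R '' (V : Set (𝒳 → ℝ))) = R g := by
  refine IsLeast.csInf_eq ⟨⟨g, hmin.1, rfl⟩, ?_⟩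
  rintro _ ⟨h, hh, rfl⟩
  exact hmin.2 h hh

/-! ### The noise and the basic inequality -/

/-- The mean of `N` independent centered variables with second moment at most `s` has second moment
at most `s / N`. -/
theorem integral_mean_sq_le {Ω : Type*} [MeasurableSpace Ω] {Q : Measure Ω} [IsProbabilityMeasure Q]
    {N : ℕ} (hN : 0 < N) {W : Fin N → Ω → ℝ} (hW : ∀ i, MemLp (W i) 2 Q) (hindep : iIndepFun W Q)
    (h0 : ∀ i, ∫ ω, W i ω ∂Q = 0) {s : ℝ} (hs : ∀ i, ∫ ω, W i ω ^ 2 ∂Q ≤ s) :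
    ∫ ω, (1 / (N : ℝ) * ∑ i, W i ω) ^ 2 ∂Q ≤ s / N := by
  have hN' : (0 : ℝ) < N := by exact_mod_cast hN
  have hmean : ∫ ω, (∑ i, W i) ω ∂Q = 0 := by
    simp_rw [Finset.sum_apply]
    rw [integral_finsetSum _ fun i _ => (hW i).integrable (by norm_num)]
    simp [h0]
  have hsum : ∫ ω, (∑ i, W i ω) ^ 2 ∂Q ≤ N * s := by
    have h1 : variance (∑ i, W i) Q = ∑ i, variance (W i) Q :=
      IndepFun.variance_sum (fun i _ => hW i) fun i _ j _ hij => hindep.indepFun hij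
    rw [variance_of_integral_eq_zero
      (memLp_finsetSum' Finset.univ fun i _ => hW i).aemeasurable hmean] at h1
    simp_rw [Finset.sum_apply] at h1
    rw [h1]
    calc ∑ i, variance (W i) Q ≤ ∑ _i : Fin N, s := by
          refine Finset.sum_le_sum fun i _ => ?_
          rw [variance_of_integral_eq_zero (hW i).aemeasurable (h0 i)]
          exact hs i
      _ = N * s := by simp
  simp_rw [mul_pow]
  rw [integral_const_mul]
  calc (1 / (N : ℝ)) ^ 2 * ∫ ω, (∑ i, W i ω) ^ 2 ∂Q ≤ (1 / (N : ℝ)) ^ 2 * (N * s) := by gcongr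
    _ = s / N := by field_simp

/-- Markov's inequality for a nonnegative variable with mean at most `t / x`; it includes the
degenerate level `t = 0`. -/
theorem measure_lt_le_one_div {Ω : Type*} [MeasurableSpace Ω] {Q : Measure Ω} {Z : Ω → ℝ}
    (hZ0 : ∀ ω, 0 ≤ Z ω) (hZ : Integrable Z Q) {t x : ℝ} (ht : 0 ≤ t)
    (hmean : ∫ ω, Z ω ∂Q ≤ t / x) : Q {ω | t < Z ω} ≤ ENNReal.ofReal (1 / x) := by
  rcases ht.eq_or_lt with rfl | htpos
  · have h1 : ∫ ω, Z ω ∂Q = 0 :=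
      le_antisymm (by simpa using hmean) (integral_nonneg hZ0)
    have h2 := (integral_eq_zero_iff_of_nonneg hZ0 hZ).1 h1
    have h3 : Q {ω | 0 < Z ω} = 0 := by
      refine measure_mono_null (fun ω hω => ?_) (ae_iff.1 h2)
      exact (ne_of_gt hω : Z ω ≠ 0)
    rw [h3]
    exact zero_le
  · have h1 := meas_ge_le_lintegral_div (μ := Q) hZ.aemeasurable.ennreal_ofReal
      (ε := ENNReal.ofReal t) (by simpa using htpos) ENNReal.ofReal_ne_top
    rw [← ofReal_integral_eq_lintegral_ofReal hZ (Filter.Eventually.of_forall hZ0),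
      ← ENNReal.ofReal_div_of_pos htpos] at h1
    refine (measure_mono fun ω hω => ?_).trans (h1.trans (ENNReal.ofReal_le_ofReal ?_))
    · exact ENNReal.ofReal_le_ofReal (le_of_lt hω)
    · rw [div_le_iff₀ htpos]
      linarith [show 1 / x * t = t / x by ring]

/-- The two noise assumptions enter only through this bound on the second moment of `ζ g(X)`. -/
theorem noise_mul_memLp_and_integral_sq_le {Ω 𝒳 : Type*} [MeasurableSpace Ω] [MeasurableSpace 𝒳]
    {P : Measure Ω} {X : Ω → 𝒳} {ζ : Ω → ℝ}
    (hζ : MemLp ζ 2 P) {σ : ℝ}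
    (hnoise : (IndepFun ζ X P ∧ ∫ ω, ζ ω ^ 2 ∂P ≤ σ ^ 2) ∨ (∀ᵐ ω ∂P, |ζ ω| ≤ σ))
    {g : 𝒳 → ℝ} (hg : Measurable g) (hg2 : MemLp (fun ω => g (X ω)) 2 P) :
    MemLp (fun ω => ζ ω * g (X ω)) 2 P ∧
      ∫ ω, (ζ ω * g (X ω)) ^ 2 ∂P ≤ σ ^ 2 * ∫ ω, g (X ω) ^ 2 ∂P := by
  have hmeas : AEStronglyMeasurable (fun ω => ζ ω * g (X ω)) P :=
    hζ.aestronglyMeasurable.mul hg2.aestronglyMeasurable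
  rcases hnoise with ⟨hind, hvar⟩ | hbdd
  · have hind2 : IndepFun (fun ω => ζ ω ^ 2) (fun ω => g (X ω) ^ 2) P :=
      hind.comp (φ := fun z : ℝ => z ^ 2) (ψ := fun x => g x ^ 2) (by fun_prop) (by fun_prop)
    have hint := hind2.integrable_mul hζ.integrable_sq hg2.integrable_sq
    have heq := hind2.integral_mul_eq_mul_integral hζ.integrable_sq.aestronglyMeasurable
      hg2.integrable_sq.aestronglyMeasurable
    simp only [Pi.mul_apply] at heq
    refine ⟨(memLp_two_iff_integrable_sq hmeas).2 ?_, ?_⟩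
    · simp_rw [mul_pow]
      exact hint
    · simp_rw [mul_pow]
      refine heq.le.trans ?_
      exact mul_le_mul_of_nonneg_right hvar (integral_nonneg fun ω => sq_nonneg _)
  · have hle : ∀ᵐ ω ∂P, (ζ ω * g (X ω)) ^ 2 ≤ σ ^ 2 * g (X ω) ^ 2 := by
      filter_upwards [hbdd] with ω hω
      rw [mul_pow]
      exact mul_le_mul_of_nonneg_right (sq_le_sq' (abs_le.1 hω).1 (abs_le.1 hω).2) (sq_nonneg _)
    have hint : Integrable (fun ω => σ ^ 2 * g (X ω) ^ 2) P := hg2.integrable_sq.const_mul _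
    have hint' : Integrable (fun ω => (ζ ω * g (X ω)) ^ 2) P := by
      refine hint.mono' (hmeas.pow 2) ?_
      filter_upwards [hle] with ω hω
      rwa [Real.norm_of_nonneg (sq_nonneg _)]
    refine ⟨(memLp_two_iff_integrable_sq hmeas).2 hint', ?_⟩
    rw [← integral_const_mul]
    exact integral_mono_ae hint' hint hle

open Matrix Classical in
/-- Deterministic part: if the empirical quadratic form of `c` is bounded below by the small-ball
count and the empirical excess risk of `c` is nonpositive, then `|c|²` is controlled by the squared
norm of the empirical noise vector `N⁻¹ ∑ z_i v_i`. -/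
theorem dotProduct_self_le_of_empirical {d N : ℕ} (hN : 0 < N) {κ β : ℝ} (hκ : 0 < κ) (hβ : 0 < β)
    {v : Fin N → Fin d → ℝ} {z : Fin N → ℝ} {c : Fin d → ℝ}
    (hcount : β * N / 8 ≤ (Finset.univ.filter fun i => κ * √(c ⬝ᵥ c) ≤ |c ⬝ᵥ v i|).card)
    (hmin : ∑ i, (z i - c ⬝ᵥ v i) ^ 2 ≤ ∑ i, z i ^ 2) :
    c ⬝ᵥ c ≤ (16 / (β * κ ^ 2)) ^ 2 * ∑ k, (1 / (N : ℝ) * ∑ i, z i * v i k) ^ 2 := by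
  have hN' : (0 : ℝ) < N := by exact_mod_cast hN
  set G : Fin d → ℝ := fun k => 1 / (N : ℝ) * ∑ i, z i * v i k with hG
  set Z := ∑ k, G k ^ 2 with hZ
  have hcc : 0 ≤ c ⬝ᵥ c := Finset.sum_nonneg fun i _ => mul_self_nonneg _
  have hlow : β * N / 8 * (κ ^ 2 * (c ⬝ᵥ c)) ≤ ∑ i, (c ⬝ᵥ v i) ^ 2 := by
    calc β * N / 8 * (κ ^ 2 * (c ⬝ᵥ c))
        ≤ (Finset.univ.filter fun i => κ * √(c ⬝ᵥ c) ≤ |c ⬝ᵥ v i|).card *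
            (κ ^ 2 * (c ⬝ᵥ c)) := by gcongr
      _ = ∑ _i ∈ Finset.univ.filter fun i => κ * √(c ⬝ᵥ c) ≤ |c ⬝ᵥ v i|, κ ^ 2 * (c ⬝ᵥ c) := by
          rw [Finset.sum_const, nsmul_eq_mul]
      _ ≤ ∑ i ∈ Finset.univ.filter fun i => κ * √(c ⬝ᵥ c) ≤ |c ⬝ᵥ v i|, (c ⬝ᵥ v i) ^ 2 := by
          refine Finset.sum_le_sum fun i hi => ?_
          have h1 := pow_le_pow_left₀ (by positivity) (Finset.mem_filter.1 hi).2 2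
          rwa [mul_pow, Real.sq_sqrt hcc, sq_abs] at h1
      _ ≤ ∑ i, (c ⬝ᵥ v i) ^ 2 :=
          Finset.sum_le_sum_of_subset_of_nonneg (Finset.filter_subset _ _)
            fun i _ _ => sq_nonneg _
  have hcross : ∑ i, z i * (c ⬝ᵥ v i) = N * ∑ k, c k * G k := by
    simp only [hG, dotProduct, Finset.mul_sum]
    rw [Finset.sum_comm]
    refine Finset.sum_congr rfl fun k _ => Finset.sum_congr rfl fun i _ => ?_
    field_simp
  have hup : ∑ i, (c ⬝ᵥ v i) ^ 2 ≤ 2 * (N * ∑ k, c k * G k) := by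
    rw [← hcross]
    have : ∑ i, (z i - c ⬝ᵥ v i) ^ 2 =
        ∑ i, z i ^ 2 - 2 * ∑ i, z i * (c ⬝ᵥ v i) + ∑ i, (c ⬝ᵥ v i) ^ 2 := by
      rw [Finset.mul_sum, ← Finset.sum_sub_distrib, ← Finset.sum_add_distrib]
      exact Finset.sum_congr rfl fun i _ => by ring
    linarith
  have hcs : (∑ k, c k * G k) ^ 2 ≤ (c ⬝ᵥ c) * Z := by
    have h1 := Finset.sum_mul_sq_le_sq_mul_sq Finset.univ c G
    simpa only [dotProduct, ← sq] using h1
  have hlin : β * κ ^ 2 / 16 * (c ⬝ᵥ c) ≤ ∑ k, c k * G k := by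
    have : N * (β * κ ^ 2 / 16 * (c ⬝ᵥ c)) ≤ N * ∑ k, c k * G k := by linarith
    exact le_of_mul_le_mul_left this hN'
  have hsq : (β * κ ^ 2 / 16 * (c ⬝ᵥ c)) ^ 2 ≤ (c ⬝ᵥ c) * Z :=
    (pow_le_pow_left₀ (by positivity) hlin 2).trans hcs
  rcases hcc.eq_or_lt with h0 | hpos
  · rw [← h0]
    exact mul_nonneg (sq_nonneg _) (Finset.sum_nonneg fun k _ => sq_nonneg _)
  · have h1 : (β * κ ^ 2 / 16) ^ 2 * (c ⬝ᵥ c) ≤ Z := by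
      refine le_of_mul_le_mul_left ?_ hpos
      linarith [show (c ⬝ᵥ c) * ((β * κ ^ 2 / 16) ^ 2 * (c ⬝ᵥ c)) =
        (β * κ ^ 2 / 16 * (c ⬝ᵥ c)) ^ 2 by ring]
    calc c ⬝ᵥ c = (16 / (β * κ ^ 2)) ^ 2 * ((β * κ ^ 2 / 16) ^ 2 * (c ⬝ᵥ c)) := by field_simp
      _ ≤ (16 / (β * κ ^ 2)) ^ 2 * Z := by gcongr

/-! ### Risk bound for the empirical risk minimizer -/

theorem theoremA {Ω Ω' 𝒳 : Type*} [MeasurableSpace Ω] [MeasurableSpace Ω'] [MeasurableSpace 𝒳]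
    -- the generic couple `(X, Y)`
    (P : Measure Ω) [IsProbabilityMeasure P]
    (X : Ω → 𝒳) (Y : Ω → ℝ) (hX : Measurable X) (hY : Measurable Y) (hY2 : MemLp Y 2 P)
    -- the dictionary
    (M : ℕ) (f : Fin M → 𝒳 → ℝ) (hf : ∀ j, Measurable (f j))
    (hf2 : ∀ j, MemLp (fun ω => f j (X ω)) 2 P)
    -- the small-ball condition
    (κ₀ β₀ : ℝ) (hκ₀ : 0 < κ₀) (hβ₀ : 0 < β₀) (hsb : SmallBall P X (dictSpan f) κ₀ β₀)
    -- the sample: `N` independent copies of `(X, Y)`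
    (N : ℕ) (hN : (400 : ℝ) ^ 2 * M / β₀ ^ 2 ≤ N)
    (Q : Measure Ω') [IsProbabilityMeasure Q]
    (Xs : Fin N → Ω' → 𝒳) (Ys : Fin N → Ω' → ℝ)
    (hindep : iIndepFun (fun i ω' => (Xs i ω', Ys i ω')) Q)
    (hident : ∀ i, IdentDistrib (fun ω' => (Xs i ω', Ys i ω')) (fun ω => (X ω, Y ω)) Q P)
    -- the oracle and the noise `ζ = Y - f*(X)`
    (fstar : 𝒳 → ℝ) (hfstar : IsArgmin (risk P X Y) (dictSpan f) fstar)
    (ζ : Ω → ℝ) (hζ : ζ = fun ω => Y ω - fstar (X ω))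
    (σ : ℝ)
    (hnoise : (IndepFun ζ X P ∧ ∫ ω, ζ ω ^ 2 ∂P ≤ σ ^ 2) ∨ (∀ᵐ ω ∂P, |ζ ω| ≤ σ))
    (x : ℝ) (hx : 0 < x) :
    ∃ A : Set Ω', MeasurableSet A ∧
      1 - Real.exp (-(β₀ ^ 2 * N / 4)) - 1 / x ≤ Q.real A ∧
      ∀ ω' ∈ A, ∀ fhat : 𝒳 → ℝ,
        IsArgmin (empiricalRisk (fun i => Xs i ω') (fun i => Ys i ω')) (dictSpan f) fhat →
          l2Norm P X (fhat - fstar) ^ 2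
              = risk P X Y fhat - sInf (risk P X Y '' (dictSpan f : Set (𝒳 → ℝ))) ∧
            risk P X Y fhat - sInf (risk P X Y '' (dictSpan f : Set (𝒳 → ℝ)))
              ≤ (16 / (β₀ * κ₀ ^ 2)) ^ 2 * (σ ^ 2 * M * x / N) := by
  classical
  obtain ⟨d, hdM, e, hespan, horth, D, hD, hXD, hcoord⟩ :=
    exists_orthonormal_coordinates P (X := X) hf hf2
  have hek : ∀ k, Measurable fun x => e x k := fun k => measurable_of_mem_dictSpan hf (hespan k)
  have he : Measurable e := measurable_pi_lambda _ hek
  have he2 : ∀ k, MemLp (fun ω => e (X ω) k) 2 P := fun k => memLp_of_mem_dictSpan hf2 (hespan k)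
  have hfsm : Measurable fstar := measurable_of_mem_dictSpan hf hfstar.1
  have hres : MemLp (fun ω => Y ω - fstar (X ω)) 2 P :=
    hY2.sub (memLp_of_mem_dictSpan hf2 hfstar.1)
  have hnorm : ∀ c : Fin d → ℝ, ∫ ω, (dotProduct c (e (X ω))) ^ 2 ∂P = dotProduct c c :=
    integral_dotProduct_sq (V := fun ω => e (X ω)) he2 horth
  have hl2sq : ∀ g : 𝒳 → ℝ, l2Norm P X g ^ 2 = ∫ ω, g (X ω) ^ 2 ∂P := fun g =>
    Real.sq_sqrt (integral_nonneg fun ω => sq_nonneg _)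
  -- the law of the coordinate vector satisfies the small-ball condition
  set μ : Measure (Fin d → ℝ) := P.map fun ω => e (X ω) with hμ
  have heX : Measurable fun ω => e (X ω) := he.comp hX
  have : IsProbabilityMeasure μ := Measure.isProbabilityMeasure_map heX.aemeasurable
  have hball : ∀ c : Fin d → ℝ, β₀ ≤ μ.real {y | κ₀ * √(dotProduct c c) ≤ |dotProduct c y|} := by
    intro c
    have hmem : (fun x => dotProduct c (e x)) ∈ dictSpan f := by
      have : (fun x => dotProduct c (e x)) = ∑ k, c k • fun x => e x k := by
        ext x; simp [dotProduct]
      rw [this]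
      exact Submodule.sum_mem _ fun k _ => Submodule.smul_mem _ _ (hespan k)
    have h1 := hsb _ hmem
    rw [l2Norm, hnorm c] at h1
    rw [hμ, map_measureReal_apply heX]
    · exact h1
    · refine measurableSet_le measurable_const ?_
      unfold dotProduct
      fun_prop
  have hNd : (400 : ℝ) ^ 2 * d / β₀ ^ 2 ≤ N := by
    refine le_trans ?_ hN
    have : (d : ℝ) ≤ M := by exact_mod_cast hdM
    gcongr
  obtain ⟨U, hU, hUle, hUcount⟩ := exists_uniform_smallBall μ hκ₀ hβ₀ hball hNd
  -- the sample of coordinate vectors has law `μ^N`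
  have hXs : ∀ i, AEMeasurable (Xs i) Q := fun i => (hident i).aemeasurable_fst.fst
  have hlaw : Q.map (fun ω' i => e (Xs i ω')) = Measure.pi fun _ : Fin N => μ := by
    have h1 : iIndepFun (fun i ω' => e (Xs i ω')) Q :=
      hindep.comp (fun _ p => e p.1) fun _ => he.comp measurable_fst
    refine (h1.map_fun_eq_pi_map fun i => he.comp_aemeasurable (hXs i)).trans ?_
    congr 1
    funext i
    exact ((hident i).comp (he.comp measurable_fst)).map_eq
  have hB₁ : Q {ω' | (fun i => e (Xs i ω')) ∈ U} ≤
      ENNReal.ofReal (Real.exp (-(β₀ ^ 2 * N / 4))) := by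
    have hmeas : AEMeasurable (fun ω' i => e (Xs i ω')) Q :=
      aemeasurable_pi_lambda _ fun i => he.comp_aemeasurable (hXs i)
    rwa [← hlaw, Measure.map_apply_of_aemeasurable hmeas hU] at hUle
  have hB₂ : ∀ᵐ ω' ∂Q, ∀ i, Xs i ω' ∈ D := by
    rw [ae_all_iff]
    intro i
    exact ((hident i).comp measurable_fst).symm.ae_mem_snd hD hXD
  -- the empirical noise vector
  set Z : Ω' → ℝ := fun ω' =>
    ∑ k, (1 / (N : ℝ) * ∑ i, (Ys i ω' - fstar (Xs i ω')) * e (Xs i ω') k) ^ 2 with hZ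
  have hB₃ : Q {ω' | σ ^ 2 * M * x / N < Z ω'} ≤ ENNReal.ofReal (1 / x) := by
    rcases Nat.eq_zero_or_pos N with rfl | hNpos
    · -- for an empty sample both sides are zero, as `1 / 0 = 0`
      simp [hZ]
    have hN' : (0 : ℝ) < N := by exact_mod_cast hNpos
    set ψ : Fin d → 𝒳 × ℝ → ℝ := fun k p => (p.2 - fstar p.1) * e p.1 k with hψ
    have hψm : ∀ k, Measurable (ψ k) := fun k =>
      (measurable_snd.sub (hfsm.comp measurable_fst)).mul ((hek k).comp measurable_fst)
    have hidψ : ∀ k i, IdentDistrib (fun ω' => ψ k (Xs i ω', Ys i ω'))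
        (fun ω => ψ k (X ω, Y ω)) Q P := fun k i => (hident i).comp (hψm k)
    have hnoise' : ∀ k, MemLp (fun ω => ψ k (X ω, Y ω)) 2 P ∧
        ∫ ω, ψ k (X ω, Y ω) ^ 2 ∂P ≤ σ ^ 2 := by
      intro k
      have h1 := noise_mul_memLp_and_integral_sq_le (hζ ▸ hres) hnoise (hek k) (he2 k)
      have h2 : ∫ ω, e (X ω) k ^ 2 ∂P = 1 := by
        simpa [sq] using horth k k
      rw [h2, mul_one, hζ] at h1
      exact h1
    have hmemW : ∀ k i, MemLp (fun ω' => ψ k (Xs i ω', Ys i ω')) 2 Q := fun k i =>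
      (hidψ k i).memLp_iff.2 (hnoise' k).1
    have hmeank : ∀ k, ∫ ω', (1 / (N : ℝ) * ∑ i, ψ k (Xs i ω', Ys i ω')) ^ 2 ∂Q ≤ σ ^ 2 / N := by
      intro k
      refine integral_mean_sq_le hNpos (hmemW k)
        (hindep.comp (fun _ => ψ k) fun _ => hψm k) (fun i => ?_) (fun i => ?_)
      · rw [(hidψ k i).integral_eq]
        exact integral_residual_mul_eq_zero hfstar (hespan k) hres (he2 k)
      · have h1 := ((hidψ k i).comp (u := fun y : ℝ => y ^ 2) (by fun_prop)).integral_eq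
        exact h1.le.trans (hnoise' k).2
    have hint : ∀ k, Integrable
        (fun ω' => (1 / (N : ℝ) * ∑ i, ψ k (Xs i ω', Ys i ω')) ^ 2) Q := fun k =>
      ((memLp_finsetSum _ fun i _ => hmemW k i).const_mul _).integrable_sq
    refine measure_lt_le_one_div (fun ω' => Finset.sum_nonneg fun k _ => sq_nonneg _)
      (integrable_finsetSum _ fun k _ => hint k) (by positivity) ?_
    rw [integral_finsetSum _ fun k _ => hint k]
    calc _ ≤ ∑ _k : Fin d, σ ^ 2 / N := Finset.sum_le_sum fun k _ => hmeank k
      _ = d * (σ ^ 2 / N) := by simp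
      _ ≤ M * (σ ^ 2 / N) := by
          have : (d : ℝ) ≤ M := by exact_mod_cast hdM
          gcongr
      _ = σ ^ 2 * M * x / N / x := by field_simp
  set B : Set Ω' := {ω' | (fun i => e (Xs i ω')) ∈ U} ∪ {ω' | σ ^ 2 * M * x / N < Z ω'} ∪
    {ω' | ¬ ∀ i, Xs i ω' ∈ D} with hBdef
  have hQB : Q.real (toMeasurable Q B) ≤ Real.exp (-(β₀ ^ 2 * N / 4)) + 1 / x := by
    rw [measureReal_def, measure_toMeasurable]
    refine ENNReal.toReal_le_of_le_ofReal (by positivity) ?_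
    rw [ENNReal.ofReal_add (by positivity) (by positivity)]
    refine (measure_union_le _ _).trans ?_
    rw [ae_iff.1 hB₂, add_zero]
    exact (measure_union_le _ _).trans (add_le_add hB₁ hB₃)
  refine ⟨(toMeasurable Q B)ᶜ, (measurableSet_toMeasurable _ _).compl, ?_, ?_⟩
  · rw [probReal_compl_eq_one_sub (measurableSet_toMeasurable _ _)]
    linarith
  intro ω' hω' fhat hfhat
  have hωB : ω' ∉ B := fun h => hω' (subset_toMeasurable Q B h)
  simp only [hBdef, Set.mem_union, not_or] at hωB
  obtain ⟨⟨hωU, hωZ⟩, hωD⟩ := hωB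
  have hωZ : Z ω' ≤ σ ^ 2 * M * x / N := not_lt.1 hωZ
  have hωD : ∀ i, Xs i ω' ∈ D := not_not.1 hωD
  have hhspan : fhat - fstar ∈ dictSpan f := Submodule.sub_mem _ hfhat.1 hfstar.1
  have hh2 : MemLp (fun ω => (fhat - fstar) (X ω)) 2 P := memLp_of_mem_dictSpan hf2 hhspan
  have hexcess : l2Norm P X (fhat - fstar) ^ 2 =
      risk P X Y fhat - sInf (risk P X Y '' (dictSpan f : Set (𝒳 → ℝ))) := by
    rw [sInf_image_risk_eq hfstar, hl2sq]
    have h1 := risk_add hres hh2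
    rw [integral_residual_mul_eq_zero hfstar hhspan hres hh2, add_sub_cancel] at h1
    linarith
  refine ⟨hexcess, ?_⟩
  rw [← hexcess]
  obtain ⟨c, hc⟩ := hcoord _ hhspan
  have hnormc : l2Norm P X (fhat - fstar) ^ 2 = dotProduct c c := by
    rw [hl2sq, ← hnorm c]
    refine integral_congr_ae ?_
    filter_upwards [hXD] with ω hω
    rw [hc _ hω]
  rw [hnormc]
  refine le_trans ?_ (mul_le_mul_of_nonneg_left hωZ (sq_nonneg _))
  rcases Nat.eq_zero_or_pos N with hN0 | hNpos
  · -- an empty sample forces an empty dictionary, hence dimension zero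
    have hM0 : M = 0 := by
      rw [hN0, Nat.cast_zero, div_le_iff₀ (by positivity), zero_mul] at hN
      have : (M : ℝ) ≤ 0 := by linarith
      exact Nat.le_zero.1 (by exact_mod_cast this)
    have hd0 : d = 0 := by omega
    subst hd0
    simp only [dotProduct, Finset.univ_eq_empty, Finset.sum_empty]
    exact mul_nonneg (sq_nonneg _) (Finset.sum_nonneg fun _ _ => sq_nonneg _)
  · refine dotProduct_self_le_of_empirical hNpos hκ₀ hβ₀ (v := fun i => e (Xs i ω'))
      (z := fun i => Ys i ω' - fstar (Xs i ω')) (by convert hUcount _ hωU c) ?_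
    have h1 := hfhat.2 fstar hfstar.1
    unfold empiricalRisk at h1
    have h2 := le_of_mul_le_mul_left h1 (by positivity : (0 : ℝ) < 1 / N)
    refine le_trans (le_of_eq ?_) h2
    refine Finset.sum_congr rfl fun i _ => ?_
    rw [← hc _ (hωD i), Pi.sub_apply]
    ring
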